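/- Let $X$ be a smooth manifold of dimension $4$ (Hausdorff, second countable, without boundary) with a smooth almost complex structure $J$, and let $c:X\to X$ be a smooth $J$-antiholomorphic involution, i.e. $c\circ c=\mathrm{id}$ and $dc\circ J=-J\circ dc$. Let $C\subset X$ be an embedded $J$-complex curve, i.e. $C$ is a closed subset which is the image of a smooth embedding of a smooth surface and $J(T_xC)=T_xC$ for every $x\in C$, and suppose that $c(C)=C$. Call *local equation* of $C$ on an open set $U\subset X$ a smooth function $f:U\to\mathbb{C}$ such that $f^{-1}(0)=C\cap U$ and such that, at every $x\in C\cap U$, the differential $df_x:T_xX\to\mathbb{C}$ is nonzero and satisfies $df_x\circ J=i\,df_x$. If $f_\alpha$, $f_\beta$ are local equations of $C$ on $U_\alpha$, $U_\beta$, the function $\frac{f_\alpha}{|f_\alpha|}\,\frac{|f_\beta|}{f_\beta}$ extends continuously from $(U_\alpha\cap U_\beta)\setminus C$ to a function $h_{\alpha\beta}:U_\alpha\cap U_\beta\to \mathrm{U}(1)$, and these functions form a cocycle. Then: 1. every point of $X$ has a neighbourhood on which $C$ has a local equation, so that the cocycle $\{h_{\alpha\beta}\}$ of all local equations defines a (topological)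 principal $\mathrm{U}(1)$-bundle $Q\to X$, the $\mathrm{U}(1)$-bundle associated with $C$; 2. $Q$ is $c$-real: there is a continuous map $\sigma:Q\to Q$ covering $c$ such that $\sigma(\lambda q)=\bar\lambda\,\sigma(q)$ for all $\lambda\in\mathrm{U}(1)$, $q\in Q$, and $\sigma\circ\sigma=\mathrm{id}_Q$. -/

import Mathlib

open scoped Manifold ContDiff Topology
open Set Filter

/-- A smooth almost complex structure on a smooth `4`-manifold: a smooth section `J` of the bundle
of endomorphisms of the tangent bundle, with `J ∘ J = -1`. -/
structure AlmostComplexStructure (X : Type*) [TopologicalSpace X]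
    [ChartedSpace (EuclideanSpace ℝ (Fin 4)) X] [IsManifold (𝓡 4) ∞ X] where
  toFun (x : X) : TangentSpace (𝓡 4) x →L[ℝ] TangentSpace (𝓡 4) x
  sq_eq_neg (x : X) (v : TangentSpace (𝓡 4) x) : toFun x (toFun x v) = -v
  smooth : ContMDiff (𝓡 4)
      ((𝓡 4).prod 𝓘(ℝ, EuclideanSpace ℝ (Fin 4) →L[ℝ] EuclideanSpace ℝ (Fin 4))) ∞
    (fun x => Bundle.TotalSpace.mk' (EuclideanSpace ℝ (Fin 4) →L[ℝ] EuclideanSpace ℝ (Fin 4))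
      (E := fun x : X => TangentSpace (𝓡 4) x →L[ℝ] TangentSpace (𝓡 4) x) x (toFun x))

/-- `c` is a smooth `J`-antiholomorphic involution: `c ∘ c = id` and `dc ∘ J = - J ∘ dc`. -/
structure IsAntiholomorphicInvolution {X : Type*} [TopologicalSpace X]
    [ChartedSpace (EuclideanSpace ℝ (Fin 4)) X] [IsManifold (𝓡 4) ∞ X]
    (J : AlmostComplexStructure X) (c : X → X) : Prop where
  smooth : ContMDiff (𝓡 4) (𝓡 4) ∞ c
  involutive : Function.Involutive c
  antiholomorphic (x : X) (v : TangentSpace (𝓡 4) x) :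
    mfderiv (𝓡 4) (𝓡 4) c x (J.toFun x v) = -J.toFun (c x) (mfderiv (𝓡 4) (𝓡 4) c x v)

/-- `j : S → X` is an embedded `J`-complex curve: `S` is a smooth surface, `j` is a smooth embedding
with closed image, and `J` preserves every tangent plane `dj(T_p S)` of the image. -/
structure IsEmbeddedJCurve {X : Type*} [TopologicalSpace X]
    [ChartedSpace (EuclideanSpace ℝ (Fin 4)) X] [IsManifold (𝓡 4) ∞ X]
    (J : AlmostComplexStructure X) {S : Type*} [TopologicalSpace S]
    [ChartedSpace (EuclideanSpace ℝ (Fin 2)) S] [IsManifold (𝓡 2) ∞ S] (j : S → X) : Prop where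
  isSmoothEmbedding : Manifold.IsSmoothEmbedding (𝓡 2) (𝓡 4) ∞ j
  isClosed_range : IsClosed (range j)
  tangent_invariant (p : S) (v : TangentSpace (𝓡 2) p) :
    ∃ w : TangentSpace (𝓡 2) p,
      J.toFun (j p) (mfderiv (𝓡 2) (𝓡 4) j p v) = mfderiv (𝓡 2) (𝓡 4) j p w

/-- A (locally trivial) principal `U(1)`-bundle over `X`, where `U(1)` is Mathlib's `Circle`. -/
structure PrincipalCircleBundle (X : Type*) [TopologicalSpace X] where
  Total : Type*
  [topology : TopologicalSpace Total]
  [action : MulAction Circle Total]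
  proj : Total → X
  proj_smul (a : Circle) (q : Total) : proj (a • q) = proj q
  exists_trivialization (x : X) : ∃ e : Bundle.Trivialization Circle proj, x ∈ e.baseSet ∧
    ∀ (a : Circle) (q : Total), proj q ∈ e.baseSet → (e (a • q)).2 = a * (e q).2

attribute [instance] PrincipalCircleBundle.topology PrincipalCircleBundle.action

/-- `Q` is `c`-real: there is an antilinear involution `σ` of `Q` covering `c`, that is, of `Q` into
`c^*Q`. Antilinear means `σ (a q) = conj a • σ q`; in `U(1)` the conjugate of `a` is `a⁻¹`. -/
def PrincipalCircleBundle.IsCReal {X : Type*} [TopologicalSpace X] (Q : PrincipalCircleBundle X)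
    (c : X → X) : Prop :=
  ∃ σ : Q.Total → Q.Total, Continuous σ ∧ (∀ q, Q.proj (σ q) = c (Q.proj q)) ∧
    (∀ (a : Circle) (q : Q.Total), σ (a • q) = a⁻¹ • σ q) ∧ ∀ q, σ (σ q) = q

/-- A local equation of `C` on an open set `U`: a smooth function on `U` that vanishes exactly on
`C ∩ U` and whose differential at the points of `C ∩ U` is nonzero and complex linear with respect
to `J`. The values of `f` outside `U` are irrelevant. -/
structure LocalEquation {X : Type*} [TopologicalSpace X]
    [ChartedSpace (EuclideanSpace ℝ (Fin 4)) X] [IsManifold (𝓡 4) ∞ X]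
    (J : AlmostComplexStructure X) (C : Set X) where
  U : Set X
  isOpen_U : IsOpen U
  f : X → ℂ
  smooth : ContMDiffOn (𝓡 4) 𝓘(ℝ, ℂ) ∞ f U
  zero_iff : ∀ x ∈ U, f x = 0 ↔ x ∈ C
  linear : ∀ x ∈ U ∩ C, ∀ v : TangentSpace (𝓡 4) x,
    mvfderiv (𝓡 4) f x (J.toFun x v) = Complex.I * mvfderiv (𝓡 4) f x v
  differential_ne_zero : ∀ x ∈ U ∩ C, mvfderiv (𝓡 4) f x ≠ 0

/-- The phase `z / |z|` of a nonzero complex number. -/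
noncomputable def circlePhase (z : ℂ) : Circle := Circle.exp z.arg

theorem coe_circlePhase {z : ℂ} (hz : z ≠ 0) : (circlePhase z : ℂ) = z / ‖z‖ := by
  have h : (‖z‖ : ℂ) ≠ 0 := by simpa using hz
  rw [circlePhase, Circle.coe_exp, eq_div_iff h, mul_comm]
  exact Complex.norm_mul_exp_arg_mul_I z

theorem circlePhase_mul {z w : ℂ} (hz : z ≠ 0) (hw : w ≠ 0) :
    circlePhase (z * w) = circlePhase z * circlePhase w := by
  apply Circle.ext
  rw [Circle.coe_mul, coe_circlePhase hz, coe_circlePhase hw, coe_circlePhase (mul_ne_zero hz hw),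
    norm_mul]
  push_cast
  rw [mul_div_mul_comm]

theorem continuousAt_circlePhase {z : ℂ} (hz : z ≠ 0) : ContinuousAt circlePhase z := by
  refine (Topology.IsInducing.subtypeVal (t := {z : ℂ | z ∈ Submonoid.unitSphere ℂ})
    |>.continuousAt_iff).2 ?_
  have h : ContinuousAt (fun w : ℂ => w / (‖w‖ : ℂ)) z :=
    continuousAt_id.div (by fun_prop) (by simpa using hz)
  refine h.congr ?_
  filter_upwards [isOpen_ne.mem_nhds hz] with w hw
  exact (coe_circlePhase hw).symm

/-- Near a point where `g` is a submersion, the distance to the zero set of `g` is controlled by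
the value of `g`. -/
theorem exists_zero_near {E : Type*} [NormedAddCommGroup E] [NormedSpace ℝ E] [CompleteSpace E]
    {g : E → ℂ} {g' : E →L[ℝ] ℂ} {p : E}
    (hg : HasStrictFDerivAt g g' p) (hsurj : Function.Surjective g') (hp : g p = 0) :
    ∃ K : ℝ, 0 < K ∧ ∀ᶠ y in 𝓝 p, ∃ z, g z = 0 ∧ ‖y - z‖ ≤ K * ‖g y‖ := by
  let N := g'.nonlinearRightInverseOfSurjective (LinearMap.range_eq_top.2 hsurj)
  have hN : 0 < N.nnnorm :=
    g'.nonlinearRightInverseOfSurjective_nnnorm_pos (LinearMap.range_eq_top.2 hsurj)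
  obtain ⟨s, hs, hs'⟩ := hg.approximates_deriv_on_nhds (c := N.nnnorm⁻¹ / 2)
    (Or.inr (by positivity))
  obtain ⟨r, hr, hrs⟩ := Metric.mem_nhds_iff.1 hs
  have hN' : (0 : ℝ) < N.nnnorm := by exact_mod_cast hN
  refine ⟨2 * N.nnnorm, by positivity, ?_⟩
  have h0 : Tendsto (fun y => 2 * (N.nnnorm : ℝ) * ‖g y‖) (𝓝 p) (𝓝 0) := by
    have := (hg.continuousAt.norm).const_mul (2 * (N.nnnorm : ℝ))
    simpa [ContinuousAt, hp] using this
  filter_upwards [Metric.ball_mem_nhds p (half_pos hr), h0.eventually (gt_mem_nhds (half_pos hr))]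
    with y hy1 hy2
  have hsub : Metric.closedBall y (2 * N.nnnorm * ‖g y‖) ⊆ s := by
    intro w hw
    apply hrs
    rw [Metric.mem_ball] at hy1 ⊢
    rw [Metric.mem_closedBall] at hw
    linarith [dist_triangle w y p]
  obtain ⟨z, hz1, hz2⟩ := hs'.surjOn_closedBall_of_nonlinearRightInverse N (by positivity) hsub
    (show (0 : ℂ) ∈ _ by
      rw [Metric.mem_closedBall, dist_zero_left]
      have : (((N.nnnorm : ℝ)⁻¹ - ((N.nnnorm⁻¹ / 2 : NNReal) : ℝ)) * (2 * N.nnnorm * ‖g y‖))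
          = ‖g y‖ := by
        push_cast
        field_simp
        ring
      rw [this])
  refine ⟨z, hz2, ?_⟩
  rwa [Metric.mem_closedBall, dist_comm, dist_eq_norm] at hz1

/-- Two functions with the same zeros near `p`, whose differentials at `p` are nonzero and
complex linear, have a quotient that tends to a nonzero limit at `p`. -/
theorem tendsto_ratio {E : Type*} [NormedAddCommGroup E] [NormedSpace ℝ E] [CompleteSpace E]
    {f g : E → ℂ} {f' g' : E →L[ℝ] ℂ} {p : E} (J : E → E)
    (hf : HasStrictFDerivAt f f' p) (hg : HasStrictFDerivAt g g' p)
    (hz : ∀ᶠ y in 𝓝 p, (g y = 0 ↔ f y = 0)) (hp : g p = 0)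
    (hfJ : ∀ v, f' (J v) = Complex.I * f' v) (hgJ : ∀ v, g' (J v) = Complex.I * g' v)
    (hf0 : f' ≠ 0) (hg0 : g' ≠ 0) :
    ∃ l : ℂ, l ≠ 0 ∧ Tendsto (fun y => f y / g y) (𝓝[{y | g y ≠ 0}] p) (𝓝 l) := by
  obtain ⟨w, hw⟩ : ∃ w, g' w ≠ 0 := by
    by_contra! h
    exact hg0 (ContinuousLinearMap.ext h)
  -- every vector is a combination of `w` and `J w` modulo the kernel
  have hdec : ∀ t : ℂ, g' (t.re • w + t.im • J w) = t * g' w := by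
    intro t
    rw [map_add, map_smul, map_smul, hgJ, Complex.real_smul, Complex.real_smul]
    conv_rhs => rw [← Complex.re_add_im t]
    ring
  have hdecf : ∀ t : ℂ, f' (t.re • w + t.im • J w) = t * f' w := by
    intro t
    rw [map_add, map_smul, map_smul, hfJ, Complex.real_smul, Complex.real_smul]
    conv_rhs => rw [← Complex.re_add_im t]
    ring
  have hsurj : Function.Surjective g' := fun t =>
    ⟨_, (hdec (t / g' w)).trans (div_mul_cancel₀ t hw)⟩
  obtain ⟨K, hK, hKz⟩ := exists_zero_near hg hsurj hp
  choose! z hz0 hzK using fun (y : E)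
    (h : ∃ z, g z = 0 ∧ ‖y - z‖ ≤ K * ‖g y‖) => h
  have hzt : Tendsto z (𝓝 p) (𝓝 p) := by
    have h0 : Tendsto (fun y => K * ‖g y‖) (𝓝 p) (𝓝 0) := by
      have := (hg.continuousAt.norm).const_mul K
      simpa [ContinuousAt, hp] using this
    have h1 : Tendsto (fun y => y - z y) (𝓝 p) (𝓝 0) :=
      squeeze_zero_norm' (hKz.mono fun y hy => hzK y hy) h0
    have := tendsto_id.sub h1
    simpa using this
  have hfz : ∀ᶠ y in 𝓝 p, f (z y) = 0 := by
    filter_upwards [hzt.eventually hz, hKz] with y h1 h2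
    exact h1.1 (hz0 y h2)
  have hpair : Tendsto (fun y => (y, z y)) (𝓝 p) (𝓝 (p, p)) := tendsto_id.prodMk_nhds hzt
  have hO : (fun y => y - z y) =O[𝓝 p] g :=
    Asymptotics.IsBigO.of_bound K (hKz.mono fun y hy => hzK y hy)
  have hfo : (fun y => f y - f' (y - z y)) =o[𝓝 p] g := by
    have := (hf.isLittleO.comp_tendsto hpair).trans_isBigO hO
    refine this.congr' ?_ EventuallyEq.rfl
    filter_upwards [hfz] with y hy
    simp [hy]
  have hgo : (fun y => g y - g' (y - z y)) =o[𝓝 p] g := by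
    have := (hg.isLittleO.comp_tendsto hpair).trans_isBigO hO
    refine this.congr' ?_ EventuallyEq.rfl
    filter_upwards [hKz] with y hy
    simp [hz0 y hy]
  -- the kernel of `g'` lies in the kernel of `f'`
  have hker : ∀ v, g' v = 0 → f' v = 0 := by
    intro v hv
    have hline : Tendsto (fun t : ℝ => p + t • v) (𝓝 0) (𝓝 p) := by
      have : Continuous (fun t : ℝ => p + t • v) := by fun_prop
      simpa using this.tendsto 0
    have hgl : (fun t : ℝ => g (p + t • v)) =o[𝓝 0] (fun t : ℝ => t) := by
      have h1 := hg.hasFDerivAt.isLittleO.comp_tendsto hline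
      have h2 : (fun t : ℝ => t • v) =O[𝓝 0] (fun t : ℝ => t) :=
        Asymptotics.IsBigO.of_bound ‖v‖ (.of_forall fun t => by
          rw [norm_smul, mul_comm])
      refine (h1.trans_isBigO (h2.congr_left fun t => by simp)).congr_left fun t => ?_
      simp [hp, hv]
    have hfl : (fun t : ℝ => f (p + t • v) - t • f' v) =o[𝓝 0] (fun t : ℝ => t) := by
      have h1 := hf.hasFDerivAt.isLittleO.comp_tendsto hline
      have h2 : (fun t : ℝ => t • v) =O[𝓝 0] (fun t : ℝ => t) :=
        Asymptotics.IsBigO.of_bound ‖v‖ (.of_forall fun t => by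
          rw [norm_smul, mul_comm])
      refine (h1.trans_isBigO (h2.congr_left fun t => by simp)).congr_left fun t => ?_
      have : f p = 0 := hz.self_of_nhds.1 hp
      simp [this]
    have hfg : (fun t : ℝ => f (p + t • v)) =o[𝓝 0] (fun t : ℝ => t) := by
      have h1 : f =O[𝓝 p] g := by
        have h2 : (fun y => f' (y - z y)) =O[𝓝 p] g := (f'.isBigO_comp _ _).trans hO
        exact (hfo.isBigO.add h2).congr_left fun y => by ring
      exact (h1.comp_tendsto hline).trans_isLittleO hgl
    have h3 : (fun t : ℝ => t • f' v) =o[𝓝 0] (fun t : ℝ => t) :=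
      (hfg.sub hfl).congr_left fun t => by ring
    by_contra hne
    have h4 : (fun t : ℝ => t) =O[𝓝 (0 : ℝ)] (fun t : ℝ => t • f' v) :=
      Asymptotics.IsBigO.of_bound (‖f' v‖⁻¹) (.of_forall fun t => by
        rw [norm_smul]
        have : ‖f' v‖ ≠ 0 := norm_ne_zero_iff.2 hne
        field_simp
        exact le_rfl)
    have h5 := h4.trans_isLittleO h3
    have h6 := h5.tendsto_div_nhds_zero
    have h7 : Tendsto (fun t : ℝ => t / t) (𝓝[≠] 0) (𝓝 0) := h6.mono_left nhdsWithin_le_nhds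
    have h8 : Tendsto (fun t : ℝ => t / t) (𝓝[≠] 0) (𝓝 1) :=
      tendsto_const_nhds.congr' (by
        filter_upwards [self_mem_nhdsWithin] with t ht
        exact (div_self ht).symm)
    exact zero_ne_one (tendsto_nhds_unique h7 h8)
  set l : ℂ := f' w / g' w with hl
  have hlin : ∀ v, f' v = l * g' v := by
    intro v
    have h1 := hdec (g' v / g' w)
    rw [div_mul_cancel₀ _ hw] at h1
    have h2 := hker (v - ((g' v / g' w).re • w + (g' v / g' w).im • J w))
      (by rw [map_sub, h1, sub_self])
    rw [map_sub, hdecf, sub_eq_zero] at h2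
    rw [h2, hl]
    ring
  refine ⟨l, fun h => hf0 (ContinuousLinearMap.ext fun v => by simp [hlin v, h]), ?_⟩
  have hmain : (fun y => f y - l * g y) =o[𝓝 p] g := by
    have := hfo.sub (hgo.const_mul_left l)
    refine this.congr_left fun y => ?_
    rw [hlin]; ring
  have h9 := (hmain.tendsto_div_nhds_zero.mono_left
    (nhdsWithin_le_nhds (s := {y | g y ≠ 0}))).add_const l
  rw [zero_add] at h9
  refine h9.congr' ?_
  filter_upwards [self_mem_nhdsWithin] with y hy
  have hy' : g y ≠ 0 := hy
  field_simp
  ring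

namespace LocalEquation

variable {X : Type*} [TopologicalSpace X] [ChartedSpace (EuclideanSpace ℝ (Fin 4)) X]
  [IsManifold (𝓡 4) ∞ X] {J : AlmostComplexStructure X} {C : Set X}

theorem nhdsWithin_compl_neBot (e : LocalEquation J C) {x : X} (hx : x ∈ e.U) :
    (𝓝[Cᶜ] x).NeBot := by
  by_contra h
  have h1 : C ∈ 𝓝 x := by
    rw [not_neBot, nhdsWithin, inf_principal_eq_bot, compl_compl] at h
    exact h
  have hxC : x ∈ C := mem_of_mem_nhds h1
  apply e.differential_ne_zero x ⟨hx, hxC⟩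
  have h2 : e.f =ᶠ[𝓝 x] fun _ => (0 : ℂ) := by
    filter_upwards [h1, e.isOpen_U.mem_nhds hx] with y hy hyU
    exact (e.zero_iff y hyU).2 hy
  exact h2.mfderiv_eq.trans mfderiv_const

/-- The differential of a local equation, computed in the chart at the point. -/
theorem hasStrictFDerivAt_chart (e : LocalEquation J C) {x : X} (hx : x ∈ e.U) :
    HasStrictFDerivAt (𝕜 := ℝ) (E := EuclideanSpace ℝ (Fin 4)) (F := ℂ)
      (e.f ∘ (extChartAt (𝓡 4) x).symm)
      (show EuclideanSpace ℝ (Fin 4) →L[ℝ] ℂ from mvfderiv (𝓡 4) e.f x)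
      (extChartAt (𝓡 4) x x) := by
  have h1 : ContMDiffAt (𝓡 4) 𝓘(ℝ, ℂ) ∞ e.f x := e.smooth.contMDiffAt (e.isOpen_U.mem_nhds hx)
  have h2 : ContDiffAt ℝ ∞ (e.f ∘ (extChartAt (𝓡 4) x).symm) (extChartAt (𝓡 4) x x) := by
    have h := (contMDiffAt_iff.1 h1).2
    rw [ModelWithCorners.range_eq_univ, contDiffWithinAt_univ] at h
    exact h
  have h3 : HasFDerivWithinAt (𝕜 := ℝ) (E := EuclideanSpace ℝ (Fin 4)) (F := ℂ)
      (e.f ∘ (extChartAt (𝓡 4) x).symm)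
      (show EuclideanSpace ℝ (Fin 4) →L[ℝ] ℂ from mvfderiv (𝓡 4) e.f x)
      (range (𝓡 4)) (extChartAt (𝓡 4) x x) :=
    (h1.mdifferentiableAt (by simp)).hasMFDerivAt.2
  rw [ModelWithCorners.range_eq_univ, hasFDerivWithinAt_univ] at h3
  exact h2.hasStrictFDerivAt' h3 (by simp)

/-- The phase of the quotient of two local equations has a limit at every common point. -/
theorem exists_tendsto (e e' : LocalEquation J C) {x : X} (hx : x ∈ e.U ∩ e'.U) :
    ∃ u : Circle, Tendsto (fun y => circlePhase (e'.f y / e.f y)) (𝓝[Cᶜ] x) (𝓝 u) := by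
  suffices h : ∃ l : ℂ, l ≠ 0 ∧ Tendsto (fun y => e'.f y / e.f y) (𝓝[Cᶜ] x) (𝓝 l) by
    obtain ⟨l, hl, h⟩ := h
    exact ⟨_, (continuousAt_circlePhase hl).tendsto.comp h⟩
  have hU : e.U ∩ e'.U ∈ 𝓝 x := (e.isOpen_U.inter e'.isOpen_U).mem_nhds hx
  by_cases hxC : x ∈ C
  · set φ := extChartAt (𝓡 4) x with hφ
    have hφx : φ.symm (φ x) = x := extChartAt_to_inv x
    have hev : ∀ᶠ z in 𝓝 (φ x), φ.symm z ∈ e.U ∩ e'.U := by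
      have h := continuousAt_extChartAt_symm (I := 𝓡 4) x
      rw [← hφ] at h
      apply h.eventually_mem
      rwa [hφx]
    have hz : ∀ᶠ z in 𝓝 (φ x), ((e.f ∘ φ.symm) z = 0 ↔ (e'.f ∘ φ.symm) z = 0) := by
      filter_upwards [hev] with z hz
      exact (e.zero_iff _ hz.1).trans (e'.zero_iff _ hz.2).symm
    obtain ⟨l, hl, h⟩ := tendsto_ratio (E := EuclideanSpace ℝ (Fin 4)) (J.toFun x) (e'.hasStrictFDerivAt_chart hx.2)
      (e.hasStrictFDerivAt_chart hx.1) hz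
      (by rw [Function.comp_apply, ← hφ, hφx]; exact (e.zero_iff x hx.1).2 hxC)
      (e'.linear x ⟨hx.2, hxC⟩) (e.linear x ⟨hx.1, hxC⟩)
      (e'.differential_ne_zero x ⟨hx.2, hxC⟩) (e.differential_ne_zero x ⟨hx.1, hxC⟩)
    refine ⟨l, hl, ?_⟩
    have hsrc : ∀ᶠ y in 𝓝[Cᶜ] x, φ.symm (φ y) = y := by
      filter_upwards [nhdsWithin_le_nhds (extChartAt_source_mem_nhds (I := 𝓡 4) x)] with y hy
      exact φ.left_inv hy
    have ht : Tendsto φ (𝓝[Cᶜ] x) (𝓝[{z | (e.f ∘ φ.symm) z ≠ 0}] (φ x)) := by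
      apply tendsto_nhdsWithin_of_tendsto_nhds_of_eventually_within
      · exact (continuousAt_extChartAt (I := 𝓡 4) x).tendsto.mono_left nhdsWithin_le_nhds
      · filter_upwards [hsrc, self_mem_nhdsWithin, nhdsWithin_le_nhds hU] with y h1 h2 h3
        change e.f (φ.symm (φ y)) ≠ 0
        rw [h1]
        exact fun h0 => h2 ((e.zero_iff y h3.1).1 h0)
    refine (h.comp ht).congr' ?_
    filter_upwards [hsrc] with y hy
    change e'.f (φ.symm (φ y)) / e.f (φ.symm (φ y)) = _
    rw [hy]
  · have h0 : e.f x ≠ 0 := fun h => hxC ((e.zero_iff x hx.1).1 h)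
    have h0' : e'.f x ≠ 0 := fun h => hxC ((e'.zero_iff x hx.2).1 h)
    have h1 : ContinuousAt e.f x := e.smooth.continuousOn.continuousAt (e.isOpen_U.mem_nhds hx.1)
    have h1' : ContinuousAt e'.f x :=
      e'.smooth.continuousOn.continuousAt (e'.isOpen_U.mem_nhds hx.2)
    exact ⟨_, div_ne_zero h0' h0, (h1'.div h1 h0).tendsto.mono_left nhdsWithin_le_nhds⟩

/-- The transition function from the trivialization given by `e` to the one given by `e'`: it is
`(f' / |f'|) (|f| / f)` outside `C`, extended by continuity to the points of `C`. -/
noncomputable def transition (e e' : LocalEquation J C) : X → Circle :=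
  extendFrom Cᶜ fun y => circlePhase (e'.f y / e.f y)

theorem tendsto_transition (e e' : LocalEquation J C) {x : X} (hx : x ∈ e.U ∩ e'.U) :
    Tendsto (fun y => circlePhase (e'.f y / e.f y)) (𝓝[Cᶜ] x) (𝓝 (transition e e' x)) :=
  tendsto_extendFrom (exists_tendsto e e' hx)

theorem continuousOn_transition (e e' : LocalEquation J C) :
    ContinuousOn (transition e e') (e.U ∩ e'.U) :=
  continuousOn_extendFrom
    (fun _ hx => mem_closure_iff_nhdsWithin_neBot.2 (e.nhdsWithin_compl_neBot hx.1))
    (fun _ hx => exists_tendsto e e' hx)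

theorem transition_self (e : LocalEquation J C) {x : X} (hx : x ∈ e.U) :
    transition e e x = 1 := by
  have := e.nhdsWithin_compl_neBot hx
  refine tendsto_nhds_unique (tendsto_transition e e ⟨hx, hx⟩) (tendsto_const_nhds.congr' ?_)
  filter_upwards [self_mem_nhdsWithin, nhdsWithin_le_nhds (e.isOpen_U.mem_nhds hx)] with y hy hyU
  have h0 : e.f y ≠ 0 := fun h => hy ((e.zero_iff y hyU).1 h)
  simp [h0, circlePhase]

theorem transition_mul (e₁ e₂ e₃ : LocalEquation J C) {x : X} (hx : x ∈ e₁.U ∩ e₂.U ∩ e₃.U) :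
    transition e₂ e₃ x * transition e₁ e₂ x = transition e₁ e₃ x := by
  have := e₁.nhdsWithin_compl_neBot hx.1.1
  refine tendsto_nhds_unique ?_ (tendsto_transition e₁ e₃ ⟨hx.1.1, hx.2⟩)
  refine ((tendsto_transition e₂ e₃ ⟨hx.1.2, hx.2⟩).mul
    (tendsto_transition e₁ e₂ hx.1)).congr' ?_
  filter_upwards [self_mem_nhdsWithin, nhdsWithin_le_nhds
    (((e₁.isOpen_U.inter e₂.isOpen_U).inter e₃.isOpen_U).mem_nhds hx)] with y hy hyU
  have h1 : e₁.f y ≠ 0 := fun h => hy ((e₁.zero_iff y hyU.1.1).1 h)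
  have h2 : e₂.f y ≠ 0 := fun h => hy ((e₂.zero_iff y hyU.1.2).1 h)
  have h3 : e₃.f y ≠ 0 := fun h => hy ((e₃.zero_iff y hyU.2).1 h)
  rw [← circlePhase_mul (div_ne_zero h3 h2) (div_ne_zero h2 h1)]
  congr 1
  field_simp

end LocalEquation

/-- `C` has a local equation near every point of `X`. -/
def HasLocalEquations {X : Type*} [TopologicalSpace X]
    [ChartedSpace (EuclideanSpace ℝ (Fin 4)) X] [IsManifold (𝓡 4) ∞ X]
    (J : AlmostComplexStructure X) (C : Set X) : Prop :=
  ∀ x : X, ∃ e : LocalEquation J C, x ∈ e.U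

/-- The circle bundle over `X` with the cocycle formed by the phases of the quotients of all local
equations of `C`. -/
noncomputable def circleBundleCore {X : Type*} [TopologicalSpace X]
    [ChartedSpace (EuclideanSpace ℝ (Fin 4)) X] [IsManifold (𝓡 4) ∞ X]
    {J : AlmostComplexStructure X} {C : Set X} (h : HasLocalEquations J C) :
    FiberBundleCore (LocalEquation J C) X Circle where
  baseSet e := e.U
  isOpen_baseSet e := e.isOpen_U
  indexAt x := (h x).choose
  mem_baseSet_at x := (h x).choose_spec
  coordChange e e' x u := e.transition e' x * u
  coordChange_self e x hx u := by rw [e.transition_self hx, one_mul]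
  continuousOn_coordChange e e' :=
    ((e.continuousOn_transition e').comp continuousOn_fst fun _ hp => hp.1).mul continuousOn_snd
  coordChange_comp e₁ e₂ e₃ x hx u := by
    rw [← mul_assoc, LocalEquation.transition_mul e₁ e₂ e₃ hx]

/-- The principal `U(1)`-bundle associated with `C`. The group acts by multiplication on the fibres,
which commutes with the transition functions. -/
noncomputable def associatedCircleBundle {X : Type*} [TopologicalSpace X]
    [ChartedSpace (EuclideanSpace ℝ (Fin 4)) X] [IsManifold (𝓡 4) ∞ X]
    {J : AlmostComplexStructure X} {C : Set X} (h : HasLocalEquations J C) :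
    PrincipalCircleBundle X where
  Total := (circleBundleCore h).TotalSpace
  action :=
    { smul := fun a q => ⟨q.1, a * (show Circle from q.2)⟩
      one_smul := fun q => congrArg (Bundle.TotalSpace.mk q.1) (one_mul (show Circle from q.2))
      mul_smul := fun a b q =>
        congrArg (Bundle.TotalSpace.mk q.1) (mul_assoc a b (show Circle from q.2)) }
  proj := (circleBundleCore h).proj
  proj_smul _ _ := rfl
  exists_trivialization x := by
    refine ⟨(circleBundleCore h).localTriv ((circleBundleCore h).indexAt x),
      (circleBundleCore h).mem_baseSet_at x, fun a q _ => ?_⟩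
    rw [FiberBundleCore.localTriv_apply, FiberBundleCore.localTriv_apply]
    exact mul_left_comm _ a (show Circle from q.2)

/-!
Local equations exist: off the closed set `C` the constant function `1` is one. Near a point of `C`,
a slice chart of the embedding gives real functions `g₀, g₁` whose common zero set is `C` and
vector fields `W₀, W₁` dual to their differentials (`exists_adapted_coordinates`). Put
`uₖ = dg₀(J Wₖ)`, which is a smooth function, and `f = g₀ - i (u₀ g₀ + u₁ g₁)`. Along `C` the kernel
of `(dg₀, dg₁)` is the tangent plane of `C`, which `J` preserves, so that
`dg₀ ∘ J = u₀ dg₀ + u₁ dg₁` there, hence `df = dg₀ - i dg₀ ∘ J`, which is complex linear. Moreover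
`u₁ ≠ 0` on `C`, and where `u₁ ≠ 0` the function `f` vanishes only where `g₀ = g₁ = 0`
(`IsEmbeddedJCurve.exists_localEquation_of_mem`).

The real structure: if `f` is a local equation on `U`, then `conj ∘ f ∘ c` is one on `c⁻¹(U)`
(`LocalEquation.conj`), and the transition functions of these conjugate equations are the conjugates
of the original ones, composed with `c` (`LocalEquation.transition_conj`). Hence sending the point
over `x` with coordinate `u` with respect to `f` to the point over `c x` with coordinate `conj u`
with respect to `conj ∘ f ∘ c` does not depend on `f`. This map (`circleBundleInvolution`) is
continuous, because it is `(x, u) ↦ (c x, u⁻¹)` in the corresponding trivializations, and it is an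
involution, because conjugating a local equation twice gives it back.
-/

/-! ### Differentials along smooth vector fields -/

section MvfderivApply

variable {E H M : Type*} [NormedAddCommGroup E] [NormedSpace ℝ E] [TopologicalSpace H]
  {I : ModelWithCorners ℝ E H} [TopologicalSpace M] [ChartedSpace H M] [IsManifold I 1 M]
  {F : Type*} [NormedAddCommGroup F] [NormedSpace ℝ F] {m n : WithTop ℕ∞}

theorem ContMDiffAt.mvfderiv_apply {g : M → F} {V : Π x : M, TangentSpace I x} {x : M}
    (hg : ContMDiffAt I 𝓘(ℝ, F) n g x)
    (hV : ContMDiffAt I I.tangent m (fun y => (V y : TangentBundle I M)) x) (hmn : m + 1 ≤ n) :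
    ContMDiffAt I 𝓘(ℝ, F) m (fun y => mvfderiv I g y (V y)) x := by
  have h1 := ContMDiffAt.clm_apply_of_inCoordinates (hg.mfderiv_const hmn) hV
    (hg.of_le (le_self_add.trans hmn))
  exact (contMDiff_snd_tangentBundle_modelSpace F 𝓘(ℝ, F)).contMDiffAt.comp x h1

end MvfderivApply

/-! ### Coordinates adapted to an embedded submanifold -/

section AdaptedCoordinates

variable {m n k : ℕ} {S X : Type*} [TopologicalSpace S] [ChartedSpace (EuclideanSpace ℝ (Fin m)) S]
  [TopologicalSpace X] [ChartedSpace (EuclideanSpace ℝ (Fin n)) X]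
  {j : S → X}

/-- The complement of an immersion, an abstract normed space, has dimension `k = n - m`, so it may
be taken to be `ℝᵏ`. -/
theorem Manifold.IsImmersionAt.isImmersionAtOfComplement_pi {p : S}
    (hj : Manifold.IsImmersionAt (𝓡 m) (𝓡 n) ∞ j p) (hk : m + k = n) :
    Manifold.IsImmersionAtOfComplement (Fin k → ℝ) (𝓡 m) (𝓡 n) ∞ j p := by
  obtain ⟨F, _, _, h⟩ := hj
  have e : (EuclideanSpace ℝ (Fin m) × F) ≃L[ℝ] EuclideanSpace ℝ (Fin n) := h.equiv
  have hfd : FiniteDimensional ℝ (EuclideanSpace ℝ (Fin m) × F) :=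
    e.symm.toLinearEquiv.finiteDimensional
  have hF : FiniteDimensional ℝ F :=
    Module.Finite.of_surjective (LinearMap.snd ℝ (EuclideanSpace ℝ (Fin m)) F) Prod.snd_surjective
  have hdim := e.toLinearEquiv.finrank_eq
  rw [Module.finrank_prod, finrank_euclideanSpace_fin, finrank_euclideanSpace_fin] at hdim
  exact h.trans_F (ContinuousLinearEquiv.ofFinrankEq (by
    rw [Module.finrank_fin_fun]; omega))

/-- Near a point of an embedded submanifold of codimension `k` there are functions `g₁, …, gₖ` whose
common zero set is the submanifold and vector fields dual to their differentials; along the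
submanifold, the common kernel of the differentials is its tangent space. -/
theorem exists_adapted_coordinates [IsManifold (𝓡 m) ∞ S] [IsManifold (𝓡 n) ∞ X]
    (hj : Manifold.IsSmoothEmbedding (𝓡 m) (𝓡 n) ∞ j) (hk : m + k = n) (p : S) :
    ∃ (U : Set X) (g : Fin k → X → ℝ) (W : Fin k → Π x : X, TangentSpace (𝓡 n) x),
      IsOpen U ∧ j p ∈ U ∧ (∀ i, ContMDiffOn (𝓡 n) 𝓘(ℝ, ℝ) ∞ (g i) U) ∧
      (∀ i, ContMDiffOn (𝓡 n) (𝓡 n).tangent ∞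
        (fun x => (W i x : TangentBundle (𝓡 n) X)) U) ∧
      (∀ x ∈ U, x ∈ range j ↔ ∀ i, g i x = 0) ∧
      (∀ x ∈ U, ∀ i l, mvfderiv (𝓡 n) (g i) x (W l x) = if i = l then 1 else 0) ∧
      ∀ q, j q ∈ U → ∀ v, (∀ i, mvfderiv (𝓡 n) (g i) (j q) v = 0) →
        ∃ w, mfderiv (𝓡 m) (𝓡 n) j q w = v := by
  have h := (hj.isImmersion.isImmersionAt p).isImmersionAtOfComplement_pi hk
  obtain ⟨φ, ψ, L, hψ, hφ, hp, hjp, hmaps, hLoc⟩ :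
      ∃ (φ : OpenPartialHomeomorph X (EuclideanSpace ℝ (Fin n)))
      (ψ : OpenPartialHomeomorph S (EuclideanSpace ℝ (Fin m)))
      (L : (EuclideanSpace ℝ (Fin m) × (Fin k → ℝ)) ≃L[ℝ] EuclideanSpace ℝ (Fin n)),
      ψ ∈ IsManifold.maximalAtlas (𝓡 m) ∞ S ∧ φ ∈ IsManifold.maximalAtlas (𝓡 n) ∞ X ∧
      p ∈ ψ.source ∧ j p ∈ φ.source ∧ (∀ q ∈ ψ.source, j q ∈ φ.source) ∧
      ∀ q ∈ ψ.source, φ (j q) = L (ψ q, 0) := by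
    refine ⟨h.codChart, h.domChart, h.equiv, h.domChart_mem_maximalAtlas,
      h.codChart_mem_maximalAtlas, h.mem_domChart_source, h.mem_codChart_source,
      h.source_subset_preimage_source, fun q hq => ?_⟩
    have hq' : h.domChart q ∈ (h.domChart.extend (𝓡 m)).target := by
      simpa using h.domChart.map_source hq
    simpa [h.domChart.left_inv hq] using h.writtenInCharts hq'
  -- `j` is an embedding, so near `j p` its image consists of the single sheet `j (ψ.source)`
  obtain ⟨O, hO, hOψ⟩ := hj.isEmbedding.isOpen_iff.1 ψ.open_source
  have hOmem : ∀ q, j q ∈ O ↔ q ∈ ψ.source := fun q => by rw [← hOψ]; rfl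
  have hφd : φ.MDifferentiable (𝓡 n) (𝓡 n) :=
    ⟨(contMDiffOn_of_mem_maximalAtlas hφ).mdifferentiableOn (by simp),
      (contMDiffOn_symm_of_mem_maximalAtlas hφ).mdifferentiableOn (by simp)⟩
  have hψd : ψ.MDifferentiable (𝓡 m) (𝓡 m) :=
    ⟨(contMDiffOn_of_mem_maximalAtlas hψ).mdifferentiableOn (by simp),
      (contMDiffOn_symm_of_mem_maximalAtlas hψ).mdifferentiableOn (by simp)⟩
  -- the transverse coordinates
  let T : Fin k → EuclideanSpace ℝ (Fin n) →L[ℝ] ℝ := fun i =>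
    ContinuousLinearMap.proj i ∘L ContinuousLinearMap.snd ℝ _ _ ∘L
      (L.symm : EuclideanSpace ℝ (Fin n) →L[ℝ] EuclideanSpace ℝ (Fin m) × (Fin k → ℝ))
  have hT : ∀ i z, T i z = (L.symm z).2 i := fun _ _ => rfl
  have hdT : ∀ i, ∀ x ∈ φ.source, ∀ v, mvfderiv (𝓡 n) (T i ∘ φ) x v =
      T i (mfderiv (𝓡 n) (𝓡 n) φ x v) := by
    intro i x hx v
    have h1 := (T i).hasMFDerivAt (x := φ x)
    have h2 := (h1.comp x (hφd.mdifferentiableAt hx).hasMFDerivAt).mfderiv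
    exact congrArg (fun A : TangentSpace (𝓡 n) x →L[ℝ] ℝ => A v) h2
  have hcont : ContinuousOn (fun x => (L.symm (φ x)).1) φ.source :=
    (continuous_fst.comp L.symm.continuous).comp_continuousOn φ.continuousOn
  let U : Set X := (φ.source ∩ (fun x => (L.symm (φ x)).1) ⁻¹' ψ.target) ∩ O
  have hUφ : U ⊆ φ.source := fun x hx => hx.1.1
  refine ⟨U, fun i => T i ∘ φ,
    fun i x => (mfderiv (𝓡 n) (𝓡 n) φ x).inverse (L (0, Pi.single i 1)),
    (hcont.isOpen_inter_preimage φ.open_source ψ.open_target).inter hO,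
    ⟨⟨hjp, ?_⟩, (hOmem p).2 hp⟩, fun i => ?_, fun i => ?_, fun x hx => ?_, fun x hx i l => ?_, ?_⟩
  · simpa [hLoc p hp] using ψ.map_source hp
  · exact (T i).contDiff.contMDiff.comp_contMDiffOn
      ((contMDiffOn_of_mem_maximalAtlas hφ).mono hUφ)
  · intro x hx
    refine ContMDiffAt.contMDiffWithinAt ?_
    refine ContMDiffAt.mpullback_vectorField_preimage (n := ∞)
      (V := fun _ => L (0, Pi.single i 1)) ?_
      (contMDiffAt_of_mem_maximalAtlas hφ (hUφ hx)) ⟨hφd.mfderiv (hUφ hx), rfl⟩ (by simp)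
    exact contMDiffAt_vectorSpace_iff_contDiffAt.2 contDiffAt_const
  · constructor
    · rintro ⟨q, rfl⟩ i
      simp [hT, hLoc q ((hOmem q).1 hx.2)]
    · intro h0
      have hq := ψ.map_target hx.1.2
      refine ⟨ψ.symm (L.symm (φ x)).1, φ.injOn (hmaps _ hq) (hUφ hx) ?_⟩
      rw [hLoc _ hq, ψ.right_inv hx.1.2, ← L.symm.injective.eq_iff, L.symm_apply_apply]
      exact Prod.ext rfl (funext fun i => (h0 i).symm)
  · rw [hdT i x (hUφ hx)]
    have hinv : (mfderiv (𝓡 n) (𝓡 n) φ x).IsInvertible := ⟨hφd.mfderiv (hUφ hx), rfl⟩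
    refine (congrArg (T i) (hinv.self_apply_inverse (L (0, Pi.single l 1)))).trans ?_
    rw [hT, L.symm_apply_apply]
    exact Pi.single_apply l 1 i
  · intro q hq v hv
    have hqψ := (hOmem q).1 hq.2
    have hjd : MDifferentiableAt (𝓡 m) (𝓡 n) j q :=
      hj.contMDiff.mdifferentiable (by simp) q
    obtain ⟨w, hw⟩ := hψd.mfderiv_surjective hqψ
      (L.symm (mfderiv (𝓡 n) (𝓡 n) φ (j q) v)).1
    refine ⟨w, hφd.mfderiv_injective (hUφ hq) ?_⟩
    -- `φ ∘ j` is `a ↦ L (a, 0)` in the chart `ψ`, so `w` and `v` have the same image under `dφ`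
    let A : EuclideanSpace ℝ (Fin m) →L[ℝ] EuclideanSpace ℝ (Fin n) :=
      (L : EuclideanSpace ℝ (Fin m) × (Fin k → ℝ) →L[ℝ] EuclideanSpace ℝ (Fin n)) ∘L
        ContinuousLinearMap.inl ℝ _ _
    have h1 := (hφd.mdifferentiableAt (hUφ hq)).hasMFDerivAt.comp q hjd.hasMFDerivAt
    have h2 := (A.hasMFDerivAt (x := ψ q)).comp q (hψd.mdifferentiableAt hqψ).hasMFDerivAt
    have h3 := hasMFDerivAt_unique h1 (h2.congr_of_eventuallyEq (by
      filter_upwards [ψ.open_source.mem_nhds hqψ] with r hr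
      exact hLoc r hr))
    have h4 : mfderiv (𝓡 n) (𝓡 n) φ (j q) (mfderiv (𝓡 m) (𝓡 n) j q w) =
        A (mfderiv (𝓡 m) (𝓡 m) ψ q w) :=
      congrArg (fun B : TangentSpace (𝓡 m) q →L[ℝ] EuclideanSpace ℝ (Fin n) => B w) h3
    rw [h4, hw]
    refine L.symm.injective ((L.symm_apply_apply _).trans (Prod.ext rfl (funext fun i => ?_)))
    exact ((hdT i _ (hUφ hq) v).symm.trans (hv i)).symm

end AdaptedCoordinates

/-! ### Existence of local equations -/

section ExistsLocalEquation

variable {X : Type*} [TopologicalSpace X] [ChartedSpace (EuclideanSpace ℝ (Fin 4)) X]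
  [IsManifold (𝓡 4) ∞ X] {J : AlmostComplexStructure X}
  {S : Type*} [TopologicalSpace S] [ChartedSpace (EuclideanSpace ℝ (Fin 2)) S]
  [IsManifold (𝓡 2) ∞ S] {j : S → X}

/-- Near a point of the curve a local equation is `f = g₀ - i (u₀ g₀ + u₁ g₁)`, in adapted
coordinates `g₀, g₁` with dual vector fields `W₀, W₁` and with `uₖ = dg₀(J Wₖ)`. -/
theorem IsEmbeddedJCurve.exists_localEquation_of_mem (hj : IsEmbeddedJCurve J j) (p : S) :
    ∃ e : LocalEquation J (range j), j p ∈ e.U := by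
  obtain ⟨U, g, W, hU, hpU, hg, hW, hzero, hdual, htan⟩ :=
    exists_adapted_coordinates (k := 2) hj.isSmoothEmbedding rfl p
  have hgd : ∀ i, ∀ x ∈ U, MDifferentiableAt (𝓡 4) 𝓘(ℝ, ℝ) (g i) x := fun i x hx =>
    ((hg i).contMDiffAt (hU.mem_nhds hx)).mdifferentiableAt (by simp)
  let u : Fin 2 → X → ℝ := fun i x => mvfderiv (𝓡 4) (g 0) x (J.toFun x (W i x))
  have hu : ∀ i, ContMDiffOn (𝓡 4) 𝓘(ℝ, ℝ) ∞ (u i) U := fun i x hx =>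
    (ContMDiffAt.mvfderiv_apply ((hg 0).contMDiffAt (hU.mem_nhds hx))
      (J.smooth.contMDiffAt.clm_bundle_apply ((hW i).contMDiffAt (hU.mem_nhds hx)))
      (by simp)).contMDiffWithinAt
  have hud : ∀ i, ∀ x ∈ U, MDifferentiableAt (𝓡 4) 𝓘(ℝ, ℝ) (u i) x := fun i x hx =>
    ((hu i).contMDiffAt (hU.mem_nhds hx)).mdifferentiableAt (by simp)
  -- `v - ∑ dgₖ(v) Wₖ` is tangent to the curve, and so is its image under `J`
  have hJ : ∀ x ∈ U ∩ range j, ∀ v : TangentSpace (𝓡 4) x,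
      mvfderiv (𝓡 4) (g 0) x (J.toFun x v) =
        u 0 x * mvfderiv (𝓡 4) (g 0) x v + u 1 x * mvfderiv (𝓡 4) (g 1) x v := by
    rintro x ⟨hx, q, rfl⟩ v
    set v' := v - (mvfderiv (𝓡 4) (g 0) (j q) v • W 0 (j q) +
      mvfderiv (𝓡 4) (g 1) (j q) v • W 1 (j q)) with hv'
    obtain ⟨w, hw⟩ := htan q hx v' fun i => by
      rw [hv', map_sub, map_add, map_smul, map_smul, hdual _ hx, hdual _ hx]
      fin_cases i <;> simp
    obtain ⟨w', hw'⟩ := hj.tangent_invariant q w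
    have h0 : mvfderiv (𝓡 4) (g 0) (j q) (J.toFun (j q) v') = 0 := by
      rw [← hw, hw']
      have hjq := hj.isSmoothEmbedding.contMDiff.mdifferentiable (by simp) q
      have h1 := ((hgd 0 _ hx).hasMFDerivAt.comp q hjq.hasMFDerivAt).mfderiv
      have h2 : g 0 ∘ j =ᶠ[𝓝 q] fun _ => (0 : ℝ) := by
        filter_upwards [hj.isSmoothEmbedding.contMDiff.continuous.continuousAt
          (hU.mem_nhds hx)] with r hr
        exact (hzero _ hr).1 ⟨r, rfl⟩ 0
      rw [h2.mfderiv_eq, mfderiv_const] at h1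
      exact congrArg (fun A : TangentSpace (𝓡 2) q →L[ℝ] ℝ => A w') h1.symm
    have hv : v = v' + (mvfderiv (𝓡 4) (g 0) (j q) v • W 0 (j q) +
      mvfderiv (𝓡 4) (g 1) (j q) v • W 1 (j q)) := by rw [hv']; abel
    conv_lhs => rw [hv]
    rw [map_add, map_add, h0, map_add, map_add, map_smul, map_smul, map_smul, map_smul]
    simp only [u, smul_eq_mul]
    ring
  -- if `u₁ = 0`, then `dg₀ ∘ J = u₀ dg₀` and `-dg₀ = dg₀ ∘ J ∘ J = u₀² dg₀`, although `dg₀ ≠ 0`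
  have hu1 : ∀ x ∈ U ∩ range j, u 1 x ≠ 0 := by
    intro x hx h0
    have h1 := hJ x hx (J.toFun x (W 0 x))
    rw [J.sq_eq_neg, map_neg, hJ x hx, h0, hdual x hx.1, hdual x hx.1] at h1
    simp at h1
    nlinarith [mul_self_nonneg (u 0 x)]
  -- `f` vanishes only on the curve where `u₁ ≠ 0`, so its domain is shrunk to that open set
  let V : Set X := U ∩ u 1 ⁻¹' {0}ᶜ
  have hV : IsOpen V := (hu 1).continuousOn.isOpen_inter_preimage hU isOpen_compl_singleton
  let f : X → ℂ :=
    g 0 • (fun _ => (1 : ℂ)) + (u 0 * g 0 + u 1 * g 1) • (fun _ => -Complex.I)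
  have hf : ∀ x, f x = g 0 x - (u 0 x * g 0 x + u 1 x * g 1 x : ℝ) * Complex.I := fun x => by
    simp [f, sub_eq_add_neg]
  have hd : ∀ x ∈ U ∩ range j, ∀ v : TangentSpace (𝓡 4) x,
      mvfderiv (𝓡 4) f x v =
        mvfderiv (𝓡 4) (g 0) x v - Complex.I * mvfderiv (𝓡 4) (g 0) x (J.toFun x v) := by
    intro x hx v
    -- the terms with derivatives of `u₀` and `u₁` vanish, because `g₀ = g₁ = 0` on the curve
    have hz := (hzero x hx.1).1 hx.2
    have hg₀ := hgd 0 x hx.1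
    have h₀ := (hud 0 x hx.1).mul hg₀
    have h₁ := (hud 1 x hx.1).mul (hgd 1 x hx.1)
    have hc : ∀ w : ℂ, MDifferentiableAt (𝓡 4) 𝓘(ℝ, ℂ) (fun _ : X => w) x :=
      fun _ => mdifferentiableAt_const
    rw [mvfderiv_add (hg₀.smul (hc 1)) ((h₀.add h₁).smul (hc _)),
      mvfderiv_smul hg₀ (hc 1), mvfderiv_smul (h₀.add h₁) (hc _), mvfderiv_add h₀ h₁,
      mvfderiv_mul (hud 0 x hx.1) hg₀, mvfderiv_mul (hud 1 x hx.1) (hgd 1 x hx.1),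
      mvfderiv_const, mvfderiv_const, hJ x hx v]
    simp only [hz, Pi.add_apply, Pi.mul_apply, mul_zero, zero_smul, smul_zero, zero_add,
      add_zero, _root_.add_apply, ContinuousLinearMap.smulRight_apply, _root_.smul_apply,
      Complex.real_smul, smul_eq_mul]
    push_cast
    ring
  refine ⟨⟨V, hV, f, ?_, fun x hx => ?_, fun x hx v => ?_, fun x hx h0 => ?_⟩, hpU,
    hu1 _ ⟨hpU, p, rfl⟩⟩
  · have hVU : V ⊆ U := inter_subset_left
    exact ((((hg 0).mono hVU).smul contMDiffOn_const).add
      (((((hu 0).mono hVU).mul ((hg 0).mono hVU)).add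
        (((hu 1).mono hVU).mul ((hg 1).mono hVU))).smul contMDiffOn_const))
  · rw [hzero x hx.1, Fin.forall_fin_two, hf, Complex.ext_iff]
    have : u 1 x ≠ 0 := hx.2
    simp +contextual [this]
  · rw [hd x ⟨hx.1.1, hx.2⟩, hd x ⟨hx.1.1, hx.2⟩, J.sq_eq_neg, map_neg, mul_sub, ← mul_assoc,
      Complex.I_mul_I]
    push_cast
    ring
  · have h1 := hd x ⟨hx.1.1, hx.2⟩ (W 0 x)
    rw [h0, hdual x hx.1.1] at h1
    simpa using congrArg Complex.re h1

theorem IsEmbeddedJCurve.hasLocalEquations (hj : IsEmbeddedJCurve J j) :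
    HasLocalEquations J (range j) := by
  intro x
  by_cases hx : x ∈ range j
  · obtain ⟨p, rfl⟩ := hx
    exact hj.exists_localEquation_of_mem p
  · exact ⟨⟨(range j)ᶜ, hj.isClosed_range.isOpen_compl, fun _ => 1, contMDiffOn_const,
      fun y hy => by simpa using hy, fun y hy => absurd hy.2 hy.1,
      fun y hy => absurd hy.2 hy.1⟩, hx⟩

end ExistsLocalEquation

/-! ### Conjugate local equations -/

theorem circlePhase_conj {z : ℂ} (hz : z ≠ 0) :
    circlePhase (Complex.conjCLE z) = (circlePhase z)⁻¹ := by
  apply Circle.ext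
  have hz' : Complex.conjCLE z ≠ 0 := by simpa using hz
  rw [Circle.coe_inv_eq_conj, coe_circlePhase hz, coe_circlePhase hz']
  simp

theorem IsAntiholomorphicInvolution.mfderiv_surjective {X : Type*} [TopologicalSpace X]
    [ChartedSpace (EuclideanSpace ℝ (Fin 4)) X] [IsManifold (𝓡 4) ∞ X]
    {J : AlmostComplexStructure X} {c : X → X}
    (hc : IsAntiholomorphicInvolution J c) (x : X) :
    Function.Surjective (mfderiv (𝓡 4) (𝓡 4) c x) := by
  have hd : ∀ y, MDifferentiableAt (𝓡 4) (𝓡 4) c y :=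
    fun y => hc.smooth.mdifferentiable (by simp) y
  -- `dc` is injective because `c ∘ c = id`, and the tangent spaces have the same dimension
  have hinj : Function.Injective (mfderiv (𝓡 4) (𝓡 4) c x) := by
    refine (injective_iff_map_eq_zero _).2 fun v hv => ?_
    have h := mfderiv_comp_apply x (hd (c x)) (hd x) v
    rw [hv, map_zero, hc.involutive.comp_self, mfderiv_id] at h
    exact h
  exact LinearMap.injective_iff_surjective (K := ℝ) (V := EuclideanSpace ℝ (Fin 4))
    (f := (show EuclideanSpace ℝ (Fin 4) →L[ℝ] EuclideanSpace ℝ (Fin 4) from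
      mfderiv (𝓡 4) (𝓡 4) c x).toLinearMap) |>.1 hinj

namespace LocalEquation

variable {X : Type*} [TopologicalSpace X] [ChartedSpace (EuclideanSpace ℝ (Fin 4)) X]
  [IsManifold (𝓡 4) ∞ X] {J : AlmostComplexStructure X} {C : Set X} {c : X → X}

theorem mvfderiv_conj (e : LocalEquation J C) (hc : IsAntiholomorphicInvolution J c) {x : X}
    (hx : c x ∈ e.U) (v : TangentSpace (𝓡 4) x) :
    mvfderiv (𝓡 4) (Complex.conjCLE ∘ e.f ∘ c) x v =
      Complex.conjCLE (mvfderiv (𝓡 4) e.f (c x) (mfderiv (𝓡 4) (𝓡 4) c x v)) := by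
  have h1 : MDifferentiableAt (𝓡 4) (𝓡 4) c x := hc.smooth.mdifferentiable (by simp) x
  have h2 : MDifferentiableAt (𝓡 4) 𝓘(ℝ, ℂ) e.f (c x) :=
    (e.smooth.contMDiffAt (e.isOpen_U.mem_nhds hx)).mdifferentiableAt (by simp)
  have h3 : HasMFDerivAt 𝓘(ℝ, ℂ) 𝓘(ℝ, ℂ) Complex.conjCLE (e.f (c x))
      (Complex.conjCLE : ℂ →L[ℝ] ℂ) :=
    (Complex.conjCLE : ℂ →L[ℝ] ℂ).hasMFDerivAt
  have h4 := (h3.comp x (h2.hasMFDerivAt.comp x h1.hasMFDerivAt)).mfderiv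
  exact congrArg (fun L : TangentSpace (𝓡 4) x →L[ℝ] ℂ => L v) h4

/-- The conjugate `conj ∘ f ∘ c` of a local equation `f` on `U`, a local equation on `c⁻¹(U)`: it is
complex linear along `C` because both `c` and the conjugation of `ℂ` are antiholomorphic. -/
noncomputable def conj (e : LocalEquation J C) (hc : IsAntiholomorphicInvolution J c)
    (hC : ∀ x, c x ∈ C ↔ x ∈ C) : LocalEquation J C where
  U := c ⁻¹' e.U
  isOpen_U := e.isOpen_U.preimage hc.smooth.continuous
  f := Complex.conjCLE ∘ e.f ∘ c
  smooth := Complex.conjCLE.contDiff.contMDiff.comp_contMDiffOn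
    (e.smooth.comp hc.smooth.contMDiffOn fun _ hx => hx)
  zero_iff x hx := by simpa using (e.zero_iff (c x) hx).trans (hC x)
  linear x hx v := by
    rw [e.mvfderiv_conj hc hx.1, e.mvfderiv_conj hc hx.1, hc.antiholomorphic, map_neg,
      e.linear (c x) ⟨hx.1, (hC x).2 hx.2⟩]
    simp
  differential_ne_zero x hx := by
    obtain ⟨w, hw⟩ : ∃ w, mvfderiv (𝓡 4) e.f (c x) w ≠ 0 := by
      by_contra! h
      exact e.differential_ne_zero (c x) ⟨hx.1, (hC x).2 hx.2⟩ (ContinuousLinearMap.ext h)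
    obtain ⟨v, rfl⟩ := hc.mfderiv_surjective x w
    refine fun h => hw ?_
    have h1 := e.mvfderiv_conj hc hx.1 v
    rw [h] at h1
    simpa using h1.symm

@[simp]
theorem conj_U (e : LocalEquation J C) (hc : IsAntiholomorphicInvolution J c)
    (hC : ∀ x, c x ∈ C ↔ x ∈ C) : (e.conj hc hC).U = c ⁻¹' e.U := rfl

/-- The transition functions of the conjugate local equations are the conjugates, that is the
inverses, of the transition functions at the image under `c`. -/
theorem transition_conj (e e' : LocalEquation J C) (hc : IsAntiholomorphicInvolution J c)
    (hC : ∀ x, c x ∈ C ↔ x ∈ C) {x : X} (hx : c x ∈ e.U ∩ e'.U) :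
    transition (e.conj hc hC) (e'.conj hc hC) x = (transition e e' (c x))⁻¹ := by
  have := (e.conj hc hC).nhdsWithin_compl_neBot (x := x) hx.1
  refine tendsto_nhds_unique (tendsto_transition _ _ ⟨hx.1, hx.2⟩) ?_
  have hct : Tendsto c (𝓝[Cᶜ] x) (𝓝[Cᶜ] (c x)) :=
    hc.smooth.continuous.continuousAt.continuousWithinAt.tendsto_nhdsWithin
      fun y hy h => hy ((hC y).1 h)
  refine ((tendsto_transition e e' hx).comp hct).inv.congr' ?_
  have hU : (e.conj hc hC).U ∩ (e'.conj hc hC).U ∈ 𝓝 x :=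
    ((e.conj hc hC).isOpen_U.inter (e'.conj hc hC).isOpen_U).mem_nhds hx
  filter_upwards [self_mem_nhdsWithin, nhdsWithin_le_nhds hU] with y hy hyU
  have h1 : e.f (c y) ≠ 0 := fun h => hy ((hC y).1 ((e.zero_iff _ hyU.1).1 h))
  have h2 : e'.f (c y) ≠ 0 := fun h => hy ((hC y).1 ((e'.zero_iff _ hyU.2).1 h))
  rw [Function.comp_apply, ← circlePhase_conj (div_ne_zero h2 h1)]
  simp [conj]

theorem conj_conj (e : LocalEquation J C) (hc : IsAntiholomorphicInvolution J c)
    (hC : ∀ x, c x ∈ C ↔ x ∈ C) : (e.conj hc hC).conj hc hC = e := by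
  have hcc : c ∘ c = id := hc.involutive.comp_self
  cases e
  simp only [conj, mk.injEq]
  constructor
  · rw [← preimage_comp, hcc, preimage_id]
  · funext x
    simp [hc.involutive x]

end LocalEquation

/-! ### The real structure of the associated circle bundle -/

section Involution

variable {X : Type*} [TopologicalSpace X] [ChartedSpace (EuclideanSpace ℝ (Fin 4)) X]
  [IsManifold (𝓡 4) ∞ X] {J : AlmostComplexStructure X} {C : Set X} {c : X → X}

/-- The real structure of the associated circle bundle: it sends the point with coordinate `u` in
the trivialization of a local equation `e` to the point with coordinate `u⁻¹`, the conjugate of `u`,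
in the trivialization of the conjugate local equation. The coordinate `q.2` refers to the local
equation chosen at `q.1`. -/
noncomputable def circleBundleInvolution (h : HasLocalEquations J C)
    (hc : IsAntiholomorphicInvolution J c) (hC : ∀ x, c x ∈ C ↔ x ∈ C)
    (q : (circleBundleCore h).TotalSpace) : (circleBundleCore h).TotalSpace :=
  ⟨c q.1, ((h q.1).choose.conj hc hC).transition (h (c q.1)).choose (c q.1) *
    (show Circle from q.2)⁻¹⟩

theorem circleBundleInvolution_involutive (h : HasLocalEquations J C)
    (hc : IsAntiholomorphicInvolution J c) (hC : ∀ x, c x ∈ C ↔ x ∈ C) :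
    Function.Involutive (circleBundleInvolution h hc hC) := by
  rintro ⟨x, u⟩
  change Circle at u
  -- `c (c x)` is only propositionally equal to `x`, hence the auxiliary point `y`
  have key : ∀ y, y = x → ((h (c x)).choose.conj hc hC).transition (h y).choose y *
      (((h x).choose.conj hc hC).transition (h (c x)).choose (c x) * u⁻¹)⁻¹ = u := by
    rintro y rfl
    have hy := (h y).choose_spec
    have hcy := (h (c y)).choose_spec
    have hccy : c (c y) = y := hc.involutive y
    have hyy : y ∈ (((h y).choose.conj hc hC).conj hc hC).U := by simpa [hccy] using hy
    rw [mul_inv_rev, inv_inv, mul_comm u, ← mul_assoc,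
      ← LocalEquation.transition_conj _ _ hc hC ⟨by simpa [hccy] using hy, hcy⟩,
      LocalEquation.transition_mul _ _ _ ⟨⟨hyy, hcy⟩, hy⟩, LocalEquation.conj_conj,
      LocalEquation.transition_self _ hy, one_mul]
  have aux : ∀ (y : X) (w : Circle), y = x → w = u →
      (⟨y, w⟩ : (circleBundleCore h).TotalSpace) = ⟨x, u⟩ := by
    rintro y w rfl rfl; rfl
  exact aux _ _ (hc.involutive x) (key _ (hc.involutive x))

theorem continuous_circleBundleInvolution (h : HasLocalEquations J C)
    (hc : IsAntiholomorphicInvolution J c) (hC : ∀ x, c x ∈ C ↔ x ∈ C) :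
    Continuous (circleBundleInvolution h hc hC) := by
  have hcont := hc.smooth.continuous
  have hproj : Continuous fun q : (circleBundleCore h).TotalSpace => q.1 :=
    (circleBundleCore h).continuous_proj
  rw [continuous_iff_continuousAt]
  intro q₀
  rw [FiberBundle.continuousAt_totalSpace]
  refine ⟨(hcont.comp hproj).continuousAt, ?_⟩
  set e := (h q₀.1).choose
  set e' := (h (c q₀.1)).choose
  have heq : q₀.1 ∈ e.U := (h q₀.1).choose_spec
  have heq' : c q₀.1 ∈ e'.U := (h (c q₀.1)).choose_spec
  have hccq : ∀ x, c (c x) = x := hc.involutive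
  have hcoord : ContinuousAt
      (fun q : (circleBundleCore h).TotalSpace => (((circleBundleCore h).localTriv e) q).2) q₀ :=
    continuous_snd.continuousAt.comp
      (((circleBundleCore h).localTriv e).continuousAt (by
        rw [FiberBundleCore.mem_localTriv_source]; exact heq))
  have htrans : ContinuousAt
      (fun q : (circleBundleCore h).TotalSpace => (e.conj hc hC).transition e' (c q.1)) q₀ :=
    (((e.conj hc hC).continuousOn_transition e').continuousAt
      (((e.conj hc hC).isOpen_U.inter e'.isOpen_U).mem_nhds
        ⟨by simpa [hccq] using heq, heq'⟩)).comp
      (f := fun q : (circleBundleCore h).TotalSpace => c q.1) (hcont.comp hproj).continuousAt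
  -- near `q₀`, from the trivialization of `e` to that of `e'`, the involution is `u ↦ t * u⁻¹` with
  -- `t` the transition function from `e.conj` to `e'` at `c x`
  refine (htrans.mul hcoord.inv).congr ?_
  filter_upwards [hproj.continuousAt (e.isOpen_U.mem_nhds heq),
    (hcont.comp hproj).continuousAt (e'.isOpen_U.mem_nhds heq')] with q hq hq'
  obtain ⟨x, u⟩ := q
  change Circle at u
  change x ∈ e.U at hq
  change c x ∈ e'.U at hq'
  have hx := (h x).choose_spec
  have hcx := (h (c x)).choose_spec
  change (e.conj hc hC).transition e' (c x) * ((h x).choose.transition e x * u)⁻¹ =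
    (h (c x)).choose.transition e' (c x) *
      (((h x).choose.conj hc hC).transition (h (c x)).choose (c x) * u⁻¹)
  have h1 := LocalEquation.transition_conj (h x).choose e hc hC (x := c x)
    (by rw [hccq]; exact ⟨hx, hq⟩)
  rw [hccq] at h1
  rw [← mul_assoc, LocalEquation.transition_mul _ _ _ ⟨⟨by simpa [hccq] using hx, hcx⟩, hq'⟩,
    mul_inv, ← mul_assoc, ← h1,
    LocalEquation.transition_mul _ _ _
      ⟨⟨by simpa [hccq] using hx, by simpa [hccq] using hq⟩, hq'⟩]

theorem associatedCircleBundle_isCReal (h : HasLocalEquations J C)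
    (hc : IsAntiholomorphicInvolution J c) (hC : ∀ x, c x ∈ C ↔ x ∈ C) :
    (associatedCircleBundle h).IsCReal c := by
  refine ⟨circleBundleInvolution h hc hC, continuous_circleBundleInvolution h hc hC,
    fun _ => rfl, fun a q => ?_, circleBundleInvolution_involutive h hc hC⟩
  refine congrArg (Bundle.TotalSpace.mk (c q.1)) ?_
  change _ * (a * (show Circle from q.2))⁻¹ = a⁻¹ * (_ * (show Circle from q.2)⁻¹)
  rw [mul_inv, mul_left_comm]
  rfl

end Involution

theorem mainTheorem9 {X : Type*} [TopologicalSpace X] [T2Space X] [SecondCountableTopology X]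
    [ChartedSpace (EuclideanSpace ℝ (Fin 4)) X] [IsManifold (𝓡 4) ∞ X]
    (J : AlmostComplexStructure X) (c : X → X) (hc : IsAntiholomorphicInvolution J c)
    {S : Type*} [TopologicalSpace S] [ChartedSpace (EuclideanSpace ℝ (Fin 2)) S]
    [IsManifold (𝓡 2) ∞ S] (j : S → X) (hj : IsEmbeddedJCurve J j)
    (hinv : c '' range j = range j) :
    ∃ h : HasLocalEquations J (range j), (associatedCircleBundle h).IsCReal c := by
  refine ⟨hj.hasLocalEquations, associatedCircleBundle_isCReal _ hc fun x => ?_⟩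
  conv_lhs => rw [← hinv]
  exact hc.involutive.injective.mem_set_image
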